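/- **Theorem 1.2.** Let $\kappa,\tau\in\mathbb R$. Let $\mathcal R(\kappa,\tau)$ be $\mathbb R^3$ if $\kappa\ge 0$ and $\mathbb D(2/\sqrt{-\kappa})\times\mathbb R$ if $\kappa<0$, where $\mathbb D(a)=\{x^2+y^2<a^2\}$, with the metric $$g=\sigma^2(dx^2+dy^2)+\big(\sigma\tau(y\,dx-x\,dy)+dz\big)^2,\qquad \sigma=\frac{4}{4+\kappa(x^2+y^2)},$$ the usual model of the homogeneous space $\mathbb E(\kappa,\tau)$. Its base is the surface with coordinates $(x,y)$ and metric $\sigma^2(dx^2+dy^2)$. Let $r>0$, with $r<2/\sqrt{-\kappa}$ if $\kappa<0$, and let $$\rho=\int_0^r\frac{4\,ds}{4+\kappa s^2}$$ be the radius of the circle $\alpha=\{x^2+y^2=r^2\}$ in the base. For $L>0$ let $\mathsf C_\alpha(L)=\{(x,y,z): x^2+y^2=r^2,\ 0\le z\le L\}$ be the truncated circular cylinder of radius $\rho$ and length $L$. Set $$L_0=\begin{cases}\dfrac{2\pi}{-\kappa}\sinh(\rho\sqrt{-\kappa})\sqrt{-\kappa+4\tau^2\tanh^2\!\big(\tfrac{\rho\sqrt{-\kappa}}2\big)}&\kappa<0,\\[2mm]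 2\pi\rho\sqrt{1+\tau^2\rho^2}&\kappa=0,\\[1mm] \dfrac{2\pi}{\kappa}\sin(\rho\sqrt{\kappa})\sqrt{\kappa+4\tau^2\tan^2\!\big(\tfrac{\rho\sqrt{\kappa}}2\big)}&\kappa>0.\end{cases}$$ If $L>L_0$ and, in the case $\kappa>0$, $\tau\ne0$, in addition $L<8|\tau|\pi/\kappa$, then $\mathsf C_\alpha(L)$ is not stable. Here $\mathsf C_\alpha(L)$ is called stable if $\mathcal A''(0)\ge 0$, where $\mathcal A(e)$ is the area of the surface at time $e$, for every smooth variation of $\mathsf C_\alpha(L)$ through immersed surfaces in $\mathcal R(\kappa,\tau)$ that fixes the boundary curves pointwise, has variation field at time $0$ normal to $\mathsf C_\alpha(L)$, and preserves the volume (the signed volume swept out between times $0$ and $e$ is $0$ for all $e$). -/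

import Mathlib

open Real Set
open scoped ContDiff

noncomputable section

namespace EKT

/-- The underlying set of the model of `E(κ,τ)`: all of `ℝ³` if `κ ≥ 0`, and
`D(2/√(-κ)) × ℝ` if `κ < 0`. -/
def model (κ : ℝ) : Set (Fin 3 → ℝ) :=
  {p | κ < 0 → p 0 ^ 2 + p 1 ^ 2 < (2 / √(-κ)) ^ 2}

/-- The conformal factor `σ = 4 / (4 + κ (x² + y²))`, positive on the model. -/
def sigma (κ : ℝ) (p : Fin 3 → ℝ) : ℝ := 4 / (4 + κ * (p 0 ^ 2 + p 1 ^ 2))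

/-- The metric `σ² (dx² + dy²) + (σ τ (y dx - x dy) + dz)²` at the point `p`,
as a bilinear form evaluated on the tangent vectors `v`, `w`. -/
def metric (κ τ : ℝ) (p v w : Fin 3 → ℝ) : ℝ :=
  sigma κ p ^ 2 * (v 0 * w 0 + v 1 * w 1)
    + (sigma κ p * τ * (p 1 * v 0 - p 0 * v 1) + v 2)
      * (sigma κ p * τ * (p 1 * w 0 - p 0 * w 1) + w 2)

/-- The Riemannian volume density `√(det g)` in the coordinates `(x,y,z)`. -/
def volumeDensity (κ τ : ℝ) (p : Fin 3 → ℝ) : ℝ :=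
  √(Matrix.det (Matrix.of fun i j : Fin 3 =>
    metric κ τ p (Pi.single i (1 : ℝ)) (Pi.single j (1 : ℝ))))

/-- The radius in `M²(κ)`, whose metric is `σ² (dx² + dy²)`, of the circle `x² + y² = r²`:
the length of the radial geodesic from the origin `(0,0)` to the circle. -/
def circleRadius (κ r : ℝ) : ℝ := ∫ s in (0 : ℝ)..r, 4 / (4 + κ * s ^ 2)

/-- The truncated circular cylinder of length `L` over the circle `x² + y² = r²`. -/
def truncatedCylinder (κ r L : ℝ) : Set (Fin 3 → ℝ) :=
  {p | p ∈ model κ ∧ p 0 ^ 2 + p 1 ^ 2 = r ^ 2 ∧ 0 ≤ p 2 ∧ p 2 ≤ L}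

/-- The parametrization `(θ,t) ↦ (r cos θ, r sin θ, t)` of the vertical cylinder. -/
def cylinderParam (r θ t : ℝ) : Fin 3 → ℝ := ![r * cos θ, r * sin θ, t]

/-- `cylinderParam` maps `[0,2π] × [0,L]` onto the truncated cylinder. -/
theorem image_cylinderParam {κ r L : ℝ} (hr : 0 < r) (hrκ : κ < 0 → r < 2 / √(-κ)) :
    (fun q : ℝ × ℝ => cylinderParam r q.1 q.2) '' (Icc 0 (2 * π) ×ˢ Icc 0 L)
      = truncatedCylinder κ r L := by
  ext p
  constructor
  · rintro ⟨⟨θ, t⟩, ⟨_, ht⟩, rfl⟩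
    have h : (r * cos θ) ^ 2 + (r * sin θ) ^ 2 = r ^ 2 := by
      linear_combination r ^ 2 * Real.sin_sq_add_cos_sq θ
    refine ⟨fun hκ => ?_, ?_, ?_, ?_⟩
    · simpa [cylinderParam, h] using pow_lt_pow_left₀ (hrκ hκ) hr.le two_ne_zero
    · simpa [cylinderParam] using h
    · simpa [cylinderParam] using ht.1
    · simpa [cylinderParam] using ht.2
  · rintro ⟨_, hp, h0, hL⟩
    have hz : ‖(⟨p 0, p 1⟩ : ℂ)‖ = r := by
      rw [Complex.norm_def, Complex.normSq_mk, ← pow_two, ← pow_two, hp, Real.sqrt_sq hr.le]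
    have hc := Complex.norm_mul_cos_arg (⟨p 0, p 1⟩ : ℂ)
    have hs := Complex.norm_mul_sin_arg (⟨p 0, p 1⟩ : ℂ)
    rw [hz] at hc hs
    obtain ⟨θ, hθ, hcos⟩ : ∃ θ ∈ Ico (0 : ℝ) (0 + 2 * π),
        (fun x => (r * cos x, r * sin x)) (Complex.arg ⟨p 0, p 1⟩)
          = (fun x => (r * cos x, r * sin x)) θ :=
      Function.Periodic.exists_mem_Ico (f := fun x => (r * cos x, r * sin x))
        (fun x => by simp) (by positivity) _ 0 |>.imp fun _ h => h
    simp only [Prod.mk.injEq] at hcos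
    refine ⟨(θ, p 2), ⟨⟨hθ.1, by linarith [hθ.2]⟩, h0, hL⟩, ?_⟩
    funext i
    fin_cases i
    · simpa [cylinderParam, ← hcos.1] using hc
    · simpa [cylinderParam, ← hcos.2] using hs
    · simp [cylinderParam]

/-- The area of the surface `Y : [0,2π] × [0,L] → E(κ,τ)`, that is, the integral of
`√(E G - F²)` for the coefficients `E, F, G` of the induced metric. -/
def area (κ τ L : ℝ) (Y : ℝ → ℝ → (Fin 3 → ℝ)) : ℝ :=
  ∫ θ in (0 : ℝ)..(2 * π), ∫ t in (0 : ℝ)..L,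
    √(metric κ τ (Y θ t) (deriv (fun x => Y x t) θ) (deriv (fun x => Y x t) θ)
        * metric κ τ (Y θ t) (deriv (fun y => Y θ y) t) (deriv (fun y => Y θ y) t)
      - metric κ τ (Y θ t) (deriv (fun x => Y x t) θ) (deriv (fun y => Y θ y) t) ^ 2)

/-- The volume functional of a variation `X` at time `e`: the signed Riemannian volume
enclosed between the surfaces at time `0` and at time `e`, that is, the integral of the
pull-back by `X` of the volume form over `[0,e] × [0,2π] × [0,L]`. -/
def enclosedVolume (κ τ L : ℝ) (X : ℝ → ℝ → ℝ → (Fin 3 → ℝ)) (e : ℝ) : ℝ :=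
  ∫ a in (0 : ℝ)..e, ∫ θ in (0 : ℝ)..(2 * π), ∫ t in (0 : ℝ)..L,
    volumeDensity κ τ (X a θ t) *
      Matrix.det (Matrix.of ![deriv (fun b => X b θ t) a, deriv (fun x => X a x t) θ,
        deriv (fun y => X a θ y) t])

/-- `X e θ t`, for `|e| < δ`, is a smooth variation with fixed boundary of the truncated cylinder
parametrized by `cylinderParam r` on `(ℝ / 2πℤ) × [0,L]`, through immersed surfaces of `E(κ,τ)`.
Smoothness up to the boundary is expressed by `X` being given smoothly for all real `t`;
only its values for `0 ≤ t ≤ L` belong to the surfaces. -/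
structure IsVariation (κ r L δ : ℝ) (X : ℝ → ℝ → ℝ → (Fin 3 → ℝ)) : Prop where
  smooth : ContDiffOn ℝ ∞ (fun q : ℝ × ℝ × ℝ => X q.1 q.2.1 q.2.2) (Ioo (-δ) δ ×ˢ univ)
  periodic : ∀ e ∈ Ioo (-δ) δ, ∀ θ t, X e (θ + 2 * π) t = X e θ t
  initial : ∀ θ, ∀ t ∈ Icc 0 L, X 0 θ t = cylinderParam r θ t
  bottom : ∀ e ∈ Ioo (-δ) δ, ∀ θ, X e θ 0 = cylinderParam r θ 0
  top : ∀ e ∈ Ioo (-δ) δ, ∀ θ, X e θ L = cylinderParam r θ L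
  mem_model : ∀ e ∈ Ioo (-δ) δ, ∀ θ, ∀ t ∈ Icc 0 L, X e θ t ∈ model κ
  immersion : ∀ e ∈ Ioo (-δ) δ, ∀ θ, ∀ t ∈ Icc 0 L,
    LinearIndependent ℝ ![deriv (fun x => X e x t) θ, deriv (fun y => X e θ y) t]

/-- The variation is normal: its variation field at time `0` is orthogonal to the cylinder. -/
def IsNormalVariation (κ τ L : ℝ) (X : ℝ → ℝ → ℝ → (Fin 3 → ℝ)) : Prop :=
  ∀ θ, ∀ t ∈ Icc 0 L,
    metric κ τ (X 0 θ t) (deriv (fun e => X e θ t) 0) (deriv (fun x => X 0 x t) θ) = 0 ∧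
    metric κ τ (X 0 θ t) (deriv (fun e => X e θ t) 0) (deriv (fun y => X 0 θ y) t) = 0

/-- The truncated cylinder of length `L` over the circle `x² + y² = r²` in `E(κ,τ)` is stable:
the second derivative of the area at time `0` is nonnegative for every normal variation with
fixed boundary that preserves the volume. -/
def IsStable (κ τ r L : ℝ) : Prop :=
  ∀ (δ : ℝ) (X : ℝ → ℝ → ℝ → (Fin 3 → ℝ)), 0 < δ → IsVariation κ r L δ X →
    IsNormalVariation κ τ L X →
    (∀ e ∈ Ioo (-δ) δ, enclosedVolume κ τ L X e = 0) →
    0 ≤ iteratedDeriv 2 (fun e => area κ τ L (X e)) 0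

/-- The critical length `L₀` for the circular cylinder of radius `ρ` in `E(κ,τ)`. -/
def criticalLength (κ τ ρ : ℝ) : ℝ :=
  if κ < 0 then
    2 * π / (-κ) * sinh (ρ * √(-κ)) * √(-κ + 4 * τ ^ 2 * tanh (ρ * √(-κ) / 2) ^ 2)
  else if κ = 0 then
    2 * π * ρ * √(1 + τ ^ 2 * ρ ^ 2)
  else
    2 * π / κ * sin (ρ * √κ) * √(κ + 4 * τ ^ 2 * tan (ρ * √κ / 2) ^ 2)

end EKT

end

/-! It suffices to find one volume-preserving normal variation with `A''(0) < 0`, and surfaces of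
revolution provide it. Describe a circle of coordinate radius `R` by `w = ∫₀ᴿ σ² s ds = 2R²/(4 +
κR²)` instead of `R`. Then `dw = σ² R dR`, so moving the slice at height `t` by `w = w₀ + e φ(t)`
encloses exactly the volume `2πe ∫ φ`; a profile of mean zero preserves volume for every `e`, with
no correction term.

In this coordinate the area is `2π ∫ √(w(2 - κw) + (1 + 4τ²w/(2 - κw)) w'²) dt`
(`area_revolutionVariation`). Let `a = σr`, so that `2πa` is the length of the base circle, `a² =
w₀(2 - κw₀)`, and `T = 1 + τ²r²`. Differentiating twice at `e = 0` gives `A''(0) = (2π/a) ∫ (T φ'² -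
φ²/a²) dt`. For `φ = sin(2πt/L)` this is negative exactly when `L > 2πa√T`, and half-angle formulas
identify `2πa√T` with `L₀` (`criticalLength_circleRadius`). -/

noncomputable section

namespace EKT

/-! ### Differentiation under the integral sign. -/

section ParametricIntegral

variable {U : Set ℝ} {F : ℝ × ℝ → ℝ}

theorem hasDerivAt_slice (hU : IsOpen U) (hF : ContDiffOn ℝ ∞ F (U ×ˢ univ)) {e : ℝ}
    (he : e ∈ U) (t : ℝ) : HasDerivAt (fun x => F (x, t)) (fderiv ℝ F (e, t) (1, 0)) e := by
  have hmem : U ×ˢ (univ : Set ℝ) ∈ nhds (e, t) :=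
    (hU.prod isOpen_univ).mem_nhds ⟨he, mem_univ _⟩
  have h1 : HasFDerivAt F (fderiv ℝ F (e, t)) (e, t) :=
    ((hF.contDiffAt hmem).differentiableAt (by simp)).hasFDerivAt
  exact h1.comp_hasDerivAt e ((hasDerivAt_id e).prodMk (hasDerivAt_const e t))

theorem contDiffOn_deriv_slice (hU : IsOpen U) (hF : ContDiffOn ℝ ∞ F (U ×ˢ univ)) :
    ContDiffOn ℝ ∞ (fun q : ℝ × ℝ => deriv (fun x => F (x, q.2)) q.1) (U ×ˢ univ) := by
  have h1 : ContDiffOn ℝ ∞ (fderiv ℝ F) (U ×ˢ univ) :=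
    hF.fderiv_of_isOpen (hU.prod isOpen_univ) (by simp)
  exact (h1.clm_apply contDiffOn_const).congr
    fun q hq => (hasDerivAt_slice hU hF hq.1 q.2).deriv

theorem continuous_slice (hF : ContDiffOn ℝ ∞ F (U ×ˢ univ)) {e : ℝ} (he : e ∈ U) :
    Continuous fun t => F (e, t) :=
  hF.continuousOn.comp_continuous (by fun_prop) fun _ => ⟨he, mem_univ _⟩

/-- The derivative of the integrand is continuous on a compact product (ball around `e`) × `[a,b]`,
so a constant dominates it. -/
theorem hasDerivAt_integral_slice (hU : IsOpen U) (hF : ContDiffOn ℝ ∞ F (U ×ˢ univ)) (a b : ℝ)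
    {e : ℝ} (he : e ∈ U) :
    HasDerivAt (fun x => ∫ t in a..b, F (x, t))
      (∫ t in a..b, deriv (fun x => F (x, t)) e) e := by
  have hF' := contDiffOn_deriv_slice hU hF
  obtain ⟨ε, hε, hball⟩ := Metric.nhds_basis_closedBall.mem_iff.1 (hU.mem_nhds he)
  obtain ⟨C, hC⟩ := ((isCompact_closedBall e ε).prod (isCompact_uIcc (a := a) (b := b))
    ).exists_bound_of_continuousOn (hF'.continuousOn.mono (prod_mono hball (subset_univ _)))
  refine (intervalIntegral.hasDerivAt_integral_of_dominated_loc_of_deriv_le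
    (F' := fun x t => deriv (fun x => F (x, t)) x) (bound := fun _ => C)
    (Metric.closedBall_mem_nhds e hε) ?_ ?_ ?_ ?_ ?_ ?_).2
  · filter_upwards [hU.mem_nhds he] with x hx
    exact (continuous_slice hF hx).aestronglyMeasurable
  · exact (continuous_slice hF he).intervalIntegrable _ _
  · exact (continuous_slice hF' he).aestronglyMeasurable
  · exact Filter.Eventually.of_forall fun t ht x hx => hC (x, t) ⟨hx, uIoc_subset_uIcc ht⟩
  · exact intervalIntegrable_const
  · exact Filter.Eventually.of_forall fun t _ x hx =>
      (hasDerivAt_slice hU hF (hball hx) t).differentiableAt.hasDerivAt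

theorem iteratedDeriv_two_integral (hU : IsOpen U) (hF : ContDiffOn ℝ ∞ F (U ×ˢ univ)) (a b : ℝ)
    {e : ℝ} (he : e ∈ U) :
    iteratedDeriv 2 (fun x => ∫ t in a..b, F (x, t)) e
      = ∫ t in a..b, deriv (fun y => deriv (fun x => F (x, t)) y) e := by
  have hev : deriv (fun x => ∫ t in a..b, F (x, t)) =ᶠ[nhds e]
      fun x => ∫ t in a..b, deriv (fun x => F (x, t)) x := by
    filter_upwards [hU.mem_nhds he] with x hx
    exact (hasDerivAt_integral_slice hU hF a b hx).deriv
  rw [iteratedDeriv_succ, iteratedDeriv_one, hev.deriv_eq]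
  exact (hasDerivAt_integral_slice hU (contDiffOn_deriv_slice hU hF) a b he).deriv

end ParametricIntegral

/-! ### The intrinsic radius of the circle and the critical length. -/

section CircleRadius

theorem one_sub_sq_half {κ r : ℝ} (hκ : κ < 0) :
    1 - (√(-κ) * r / 2) ^ 2 = (4 + κ * r ^ 2) / 4 := by
  have := Real.sq_sqrt (neg_pos.2 hκ).le
  linear_combination (-r ^ 2 / 4) * this

theorem four_add_mul_sq_pos {κ r : ℝ} (hr : 0 ≤ r) (hrκ : κ < 0 → r < 2 / √(-κ)) :
    0 < 4 + κ * r ^ 2 := by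
  rcases lt_or_ge κ 0 with hκ | hκ
  · have hm : 0 < √(-κ) := Real.sqrt_pos.2 (neg_pos.2 hκ)
    have h1 : √(-κ) * r / 2 < 1 := by
      have := (lt_div_iff₀ hm).1 (hrκ hκ)
      linarith
    have h2 : 0 ≤ √(-κ) * r / 2 := by positivity
    have := one_sub_sq_half (r := r) hκ
    nlinarith
  · positivity

theorem circleRadius_eq_of_hasDerivAt {κ r : ℝ} (hr : 0 ≤ r) (hrκ : κ < 0 → r < 2 / √(-κ))
    {G : ℝ → ℝ} (hG : ∀ s, 0 ≤ s → s ≤ r → HasDerivAt G (4 / (4 + κ * s ^ 2)) s) :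
    circleRadius κ r = G r - G 0 := by
  refine intervalIntegral.integral_eq_sub_of_hasDerivAt ?_ ?_
  · intro s hs
    rw [uIcc_of_le hr] at hs
    exact hG s hs.1 hs.2
  · refine ContinuousOn.intervalIntegrable fun s hs => ContinuousAt.continuousWithinAt ?_
    rw [uIcc_of_le hr] at hs
    have := four_add_mul_sq_pos hs.1 fun hκ => hs.2.trans_lt (hrκ hκ)
    exact continuousAt_const.div (by fun_prop) this.ne'

theorem circleRadius_of_pos {κ r : ℝ} (hκ : 0 < κ) (hr : 0 ≤ r) :
    circleRadius κ r * √κ = 2 * arctan (√κ * r / 2) := by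
  have hm : 0 < √κ := Real.sqrt_pos.2 hκ
  have hsq := Real.sq_sqrt hκ.le
  rw [circleRadius_eq_of_hasDerivAt (G := fun s => 2 / √κ * arctan (√κ * s / 2)) hr
    (fun h => absurd h hκ.not_gt)]
  · simp only [mul_zero, zero_div, arctan_zero, sub_zero]
    field_simp
  · intro s _ _
    have h := (((hasDerivAt_id s).const_mul √κ).div_const 2).arctan.const_mul (2 / √κ)
    refine h.congr_deriv ?_
    have : 0 < 4 + κ * s ^ 2 := by positivity
    have h2 : 1 + (√κ * s / 2) ^ 2 = (4 + κ * s ^ 2) / 4 := by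
      linear_combination (s ^ 2 / 4) * hsq
    simp only [id, h2]
    field_simp

theorem circleRadius_of_neg {κ r : ℝ} (hκ : κ < 0) (hr : 0 ≤ r) (hrκ : r < 2 / √(-κ)) :
    circleRadius κ r * √(-κ) = log (1 + √(-κ) * r / 2) - log (1 - √(-κ) * r / 2) := by
  have hm : 0 < √(-κ) := Real.sqrt_pos.2 (neg_pos.2 hκ)
  rw [circleRadius_eq_of_hasDerivAt
    (G := fun s => 1 / √(-κ) * (log (1 + √(-κ) * s / 2) - log (1 - √(-κ) * s / 2))) hr
    (fun _ => hrκ)]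
  · simp only [mul_zero, zero_div, add_zero, sub_zero, log_one]
    field_simp
  · intro s hs hsr
    have hlt : √(-κ) * s / 2 < 1 := by
      have := (lt_div_iff₀ hm).1 (hsr.trans_lt hrκ)
      linarith
    have hp : 0 < 1 + √(-κ) * s / 2 := by positivity
    have hn : 0 < 1 - √(-κ) * s / 2 := by linarith
    have hd := ((hasDerivAt_id s).const_mul √(-κ)).div_const 2
    have h := (((hd.const_add 1).log hp.ne').sub ((hd.const_sub 1).log hn.ne')).const_mul
      (1 / √(-κ))
    refine h.congr_deriv ?_
    have h2 := one_sub_sq_half (r := s) hκ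
    have h3 : 4 + κ * s ^ 2 = 4 * ((1 + √(-κ) * s / 2) * (1 - √(-κ) * s / 2)) := by
      linear_combination (-4) * h2
    simp only [id, h3]
    generalize √(-κ) * s / 2 = x at hp hn ⊢
    field_simp
    ring

/-- With `x = √|κ| r / 2`, the half angle `ρ√|κ|/2` is `arctan x` or `artanh x`. Hence the `sin` or
`sinh` factor is a rational function of `r`, and the three cases collapse into one formula. -/
theorem criticalLength_circleRadius (κ τ r : ℝ) (hr : 0 < r) (hrκ : κ < 0 → r < 2 / √(-κ)) :
    criticalLength κ τ (circleRadius κ r)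
      = 2 * π * (4 * r / (4 + κ * r ^ 2)) * √(1 + τ ^ 2 * r ^ 2) := by
  have hpos := four_add_mul_sq_pos hr.le hrκ
  rcases lt_trichotomy κ 0 with hκ | hκ | hκ
  · have hκ' := neg_pos.2 hκ
    have hm : 0 < √(-κ) := Real.sqrt_pos.2 hκ'
    have hsq := Real.sq_sqrt hκ'.le
    have hlt : √(-κ) * r / 2 < 1 := by
      have := (lt_div_iff₀ hm).1 (hrκ hκ)
      linarith
    have hp : 0 < 1 + √(-κ) * r / 2 := by positivity
    have hn : 0 < 1 - √(-κ) * r / 2 := by linarith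
    have h2 := one_sub_sq_half (r := r) hκ
    have hu := circleRadius_of_neg hκ hr.le (hrκ hκ)
    have hexp : exp (circleRadius κ r * √(-κ)) = (1 + √(-κ) * r / 2) / (1 - √(-κ) * r / 2) := by
      rw [hu, exp_sub, exp_log hp, exp_log hn]
    have hsinh : sinh (circleRadius κ r * √(-κ)) = 4 * √(-κ) * r / (4 + κ * r ^ 2) := by
      have h3 : 4 + κ * r ^ 2 = 4 * ((1 + √(-κ) * r / 2) * (1 - √(-κ) * r / 2)) := by
        linear_combination (-4) * h2
      rw [sinh_eq, exp_neg, hexp, h3]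
      field_simp
      ring
    have htanh : tanh (circleRadius κ r * √(-κ) / 2) = √(-κ) * r / 2 := by
      -- With `E = exp(ρ√(-κ)/2)`, `tanh` of the half angle is `(E² - 1)/(E² + 1)`, so only `E²` is
      -- needed.
      have hhalf : exp (circleRadius κ r * √(-κ) / 2) ^ 2
          = (1 + √(-κ) * r / 2) / (1 - √(-κ) * r / 2) := by
        rw [← hexp, ← exp_nat_mul]
        congr 1
        push_cast
        ring
      have hE := exp_pos (circleRadius κ r * √(-κ) / 2)
      rw [tanh_eq_sinh_div_cosh, sinh_eq, cosh_eq, exp_neg]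
      generalize exp (circleRadius κ r * √(-κ) / 2) = E at *
      rw [eq_div_iff hn.ne'] at hhalf
      have : 0 < E + E⁻¹ := by positivity
      rw [div_div_div_cancel_right₀ two_ne_zero, div_eq_iff this.ne']
      field_simp
      linarith
    rw [criticalLength, if_pos hκ, hsinh, htanh]
    have h4 : -κ + 4 * τ ^ 2 * (√(-κ) * r / 2) ^ 2 = (-κ) * (1 + τ ^ 2 * r ^ 2) := by
      linear_combination τ ^ 2 * r ^ 2 * hsq
    rw [h4, Real.sqrt_mul hκ'.le]
    generalize √(-κ) = m at *
    rw [← hsq]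
    field_simp
  · subst hκ
    have : circleRadius 0 r = r := by simp [circleRadius]
    rw [criticalLength, if_neg (lt_irrefl _), if_pos rfl, this]
    ring_nf
  · have hm : 0 < √κ := Real.sqrt_pos.2 hκ
    have hsq := Real.sq_sqrt hκ.le
    have hu := circleRadius_of_pos hκ hr.le
    have h2 : 1 + (√κ * r / 2) ^ 2 = (4 + κ * r ^ 2) / 4 := by
      linear_combination (r ^ 2 / 4) * hsq
    have hsin : sin (circleRadius κ r * √κ) = 4 * √κ * r / (4 + κ * r ^ 2) := by
      have h3 : 0 < √(1 + (√κ * r / 2) ^ 2) := by positivity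
      have h4 := Real.sq_sqrt (show 0 ≤ 1 + (√κ * r / 2) ^ 2 by positivity)
      rw [hu, sin_two_mul, sin_arctan, cos_arctan]
      generalize √(1 + (√κ * r / 2) ^ 2) = q at *
      rw [h2] at h4
      have h5 : 4 + κ * r ^ 2 = 4 * q ^ 2 := by linarith
      rw [h5]
      field_simp
    have htan : tan (circleRadius κ r * √κ / 2) = √κ * r / 2 := by
      rw [hu, mul_div_cancel_left₀ _ two_ne_zero, tan_arctan]
    rw [criticalLength, if_neg hκ.not_gt, if_neg hκ.ne', hsin, htan]
    have h4 : κ + 4 * τ ^ 2 * (√κ * r / 2) ^ 2 = κ * (1 + τ ^ 2 * r ^ 2) := by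
      linear_combination τ ^ 2 * r ^ 2 * hsq
    rw [h4, Real.sqrt_mul hκ.le]
    generalize √κ = m at *
    rw [← hsq]
    field_simp

end CircleRadius

/-- The coordinate radius `R` of the circle for which `∫₀ᴿ σ² s ds = w`. -/
def radiusOfVolume (κ w : ℝ) : ℝ := √(4 * w / (2 - κ * w))

/-! ### The volume coordinate on circles. -/

section RadiusOfVolume

variable {κ w : ℝ}

theorem radiusOfVolume_sq (hw : 0 < w) (hκ : 0 < 2 - κ * w) :
    radiusOfVolume κ w ^ 2 = 4 * w / (2 - κ * w) :=
  Real.sq_sqrt (by positivity)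

theorem radiusOfVolume_pos (hw : 0 < w) (hκ : 0 < 2 - κ * w) : 0 < radiusOfVolume κ w :=
  Real.sqrt_pos.2 (by positivity)

theorem conformalFactor_radiusOfVolume (hw : 0 < w) (hκ : 0 < 2 - κ * w) :
    4 / (4 + κ * radiusOfVolume κ w ^ 2) = (2 - κ * w) / 2 := by
  have h : 4 + κ * radiusOfVolume κ w ^ 2 = 8 / (2 - κ * w) := by
    rw [radiusOfVolume_sq hw hκ]
    field_simp
    ring
  rw [h]
  field_simp
  norm_num

/-- The derivative is `1/(σ²R)`, the inverse of `dw/dR`, with `σ = (2 - κw)/2`. -/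
theorem hasDerivAt_radiusOfVolume (hw : 0 < w) (hκ : 0 < 2 - κ * w) :
    HasDerivAt (radiusOfVolume κ) (4 / ((2 - κ * w) ^ 2 * radiusOfVolume κ w)) w := by
  have h1 : HasDerivAt (fun w => 4 * w / (2 - κ * w)) (8 / (2 - κ * w) ^ 2) w := by
    have := ((hasDerivAt_id w).const_mul 4).div (((hasDerivAt_id w).const_mul κ).const_sub 2)
      hκ.ne'
    refine this.congr_deriv ?_
    simp only [id]
    congr 1
    ring
  have h2 := h1.sqrt (by positivity)
  refine h2.congr_deriv ?_
  have := radiusOfVolume_pos hw hκ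
  change _ / (2 * radiusOfVolume κ w) = _
  field_simp
  norm_num

theorem contDiffOn_radiusOfVolume :
    ContDiffOn ℝ ∞ (radiusOfVolume κ) {w | 0 < w ∧ 0 < 2 - κ * w} := by
  refine ContDiffOn.sqrt (ContDiffOn.div (by fun_prop) (by fun_prop) fun w hw => hw.2.ne') ?_
  rintro w ⟨h1, h2⟩
  positivity

theorem radiusOfVolume_of_circle {r : ℝ} (hr : 0 < r) (h : 0 < 4 + κ * r ^ 2) :
    radiusOfVolume κ (2 * r ^ 2 / (4 + κ * r ^ 2)) = r := by
  have h1 : 2 - κ * (2 * r ^ 2 / (4 + κ * r ^ 2)) = 8 / (4 + κ * r ^ 2) := by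
    field_simp
    ring
  have h2 : 4 * (2 * r ^ 2 / (4 + κ * r ^ 2)) / (8 / (4 + κ * r ^ 2)) = r ^ 2 := by
    generalize 4 + κ * r ^ 2 = D at *
    field_simp
    norm_num
  rw [radiusOfVolume, h1, h2, Real.sqrt_sq hr.le]

end RadiusOfVolume

/-! ### Geometry of surfaces of revolution. -/

section RotationalSurface

theorem hasDerivAt_cylinderParam_angle (R θ t : ℝ) :
    HasDerivAt (fun x => cylinderParam R x t) ![-(R * sin θ), R * cos θ, 0] θ := by
  rw [hasDerivAt_pi]
  intro i
  fin_cases i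
  · simpa [cylinderParam] using (hasDerivAt_cos θ).const_mul R
  · simpa [cylinderParam] using (hasDerivAt_sin θ).const_mul R
  · simpa [cylinderParam] using hasDerivAt_const θ t

theorem hasDerivAt_cylinderParam_height {R : ℝ → ℝ} {R' t : ℝ} (h : HasDerivAt R R' t) (θ : ℝ) :
    HasDerivAt (fun y => cylinderParam (R y) θ y) ![R' * cos θ, R' * sin θ, 1] t := by
  rw [hasDerivAt_pi]
  intro i
  fin_cases i
  · simpa [cylinderParam] using h.mul_const (cos θ)
  · simpa [cylinderParam] using h.mul_const (sin θ)
  · simpa [cylinderParam] using hasDerivAt_id' t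

theorem hasDerivAt_cylinderParam_radius {R : ℝ → ℝ} {R' e : ℝ} (h : HasDerivAt R R' e)
    (θ t : ℝ) :
    HasDerivAt (fun b => cylinderParam (R b) θ t) ![R' * cos θ, R' * sin θ, 0] e := by
  rw [hasDerivAt_pi]
  intro i
  fin_cases i
  · simpa [cylinderParam] using h.mul_const (cos θ)
  · simpa [cylinderParam] using h.mul_const (sin θ)
  · simpa [cylinderParam] using hasDerivAt_const e t

theorem sigma_cylinderParam (κ R θ t : ℝ) :
    sigma κ (cylinderParam R θ t) = 4 / (4 + κ * R ^ 2) := by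
  have : (R * cos θ) ^ 2 + (R * sin θ) ^ 2 = R ^ 2 := by
    linear_combination R ^ 2 * sin_sq_add_cos_sq θ
  simp [sigma, cylinderParam, this]

/-- The coframe `σ dx`, `σ dy`, `dz + στ(y dx - x dy)` is triangular with diagonal `σ, σ, 1`, so `τ`
drops out. -/
theorem volumeDensity_eq (κ τ : ℝ) (p : Fin 3 → ℝ) : volumeDensity κ τ p = sigma κ p ^ 2 := by
  have : Matrix.det (Matrix.of fun i j : Fin 3 =>
      metric κ τ p (Pi.single i (1 : ℝ)) (Pi.single j (1 : ℝ))) = (sigma κ p ^ 2) ^ 2 := by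
    simp [Matrix.det_fin_three, metric, Pi.single_apply]
    ring
  rw [volumeDensity, this, Real.sqrt_sq (by positivity)]

/-- The tangents `u` and `v` are not orthogonal when `τ ≠ 0`, but `F² = S²τ²R⁴` cancels the `τ` part
of `E` in `EG - F²`. Thus `τ` survives only in the coefficient of `R'²`. -/
theorem gram_cylinderParam (κ τ R R' θ t : ℝ) :
    let p := cylinderParam R θ t
    let u : Fin 3 → ℝ := ![-(R * sin θ), R * cos θ, 0]
    let v : Fin 3 → ℝ := ![R' * cos θ, R' * sin θ, 1]
    metric κ τ p u u * metric κ τ p v v - metric κ τ p u v ^ 2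
      = (4 / (4 + κ * R ^ 2)) ^ 2 * R ^ 2
        * (1 + (1 + τ ^ 2 * R ^ 2) * ((4 / (4 + κ * R ^ 2)) ^ 2 * R' ^ 2)) := by
  intro p u v
  have hσ := sigma_cylinderParam κ R θ t
  have hcs := sin_sq_add_cos_sq θ
  generalize 4 / (4 + κ * R ^ 2) = S at *
  have huu : metric κ τ p u u = S ^ 2 * R ^ 2 + S ^ 2 * τ ^ 2 * R ^ 4 := by
    simp only [metric, p, u, hσ]
    simp only [cylinderParam, Matrix.cons_val]
    linear_combination (S ^ 2 * R ^ 2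
      + S ^ 2 * τ ^ 2 * R ^ 4 * (sin θ ^ 2 + cos θ ^ 2 + 1)) * hcs
  have hvv : metric κ τ p v v = S ^ 2 * R' ^ 2 + 1 := by
    simp only [metric, p, v, hσ]
    simp only [cylinderParam, Matrix.cons_val]
    linear_combination (S ^ 2 * R' ^ 2) * hcs
  have huv : metric κ τ p u v = -(S * τ * R ^ 2) := by
    simp only [metric, p, u, v, hσ]
    simp only [cylinderParam, Matrix.cons_val]
    linear_combination (-(S * τ * R ^ 2)) * hcs
  rw [huu, hvv, huv]
  ring

end RotationalSurface

/-- The variation by surfaces of revolution for which the enclosed volume of the slice at height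
`t` grows linearly in the time `e`, with speed `φ t`. -/
def revolutionVariation (κ w₀ : ℝ) (φ : ℝ → ℝ) (e θ t : ℝ) : Fin 3 → ℝ :=
  cylinderParam (radiusOfVolume κ (w₀ + e * φ t)) θ t

/-! ### Admissibility, enclosed volume and area of the variation. -/

section RevolutionVariation

variable {κ w₀ δ : ℝ} {φ : ℝ → ℝ}

theorem isVariation_revolutionVariation {r L : ℝ}
    (h : ∀ e ∈ Ioo (-δ) δ, ∀ t, 0 < w₀ + e * φ t ∧ 0 < 2 - κ * (w₀ + e * φ t))
    (hφ : ContDiff ℝ ∞ φ) (h0 : φ 0 = 0) (hL : φ L = 0) (hr : radiusOfVolume κ w₀ = r) :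
    IsVariation κ r L δ (revolutionVariation κ w₀ φ) where
  smooth := by
    have hR : ContDiffOn ℝ ∞ (fun q : ℝ × ℝ × ℝ => radiusOfVolume κ (w₀ + q.1 * φ q.2.2))
        (Ioo (-δ) δ ×ˢ univ) :=
      contDiffOn_radiusOfVolume.comp (ContDiff.contDiffOn (by fun_prop))
        fun q hq => h q.1 hq.1 q.2.2
    rw [contDiffOn_pi]
    intro i
    fin_cases i
    · simpa [revolutionVariation, cylinderParam] using hR.mul (by fun_prop :
        ContDiffOn ℝ ∞ (fun q : ℝ × ℝ × ℝ => cos q.2.1) _)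
    · simpa [revolutionVariation, cylinderParam] using hR.mul (by fun_prop :
        ContDiffOn ℝ ∞ (fun q : ℝ × ℝ × ℝ => sin q.2.1) _)
    · simpa [revolutionVariation, cylinderParam] using (by fun_prop :
        ContDiffOn ℝ ∞ (fun q : ℝ × ℝ × ℝ => q.2.2) _)
  periodic e _ θ t := by simp [revolutionVariation, cylinderParam]
  initial θ t _ := by simp [revolutionVariation, hr]
  bottom e _ θ := by simp [revolutionVariation, hr, h0]
  top e _ θ := by simp [revolutionVariation, hr, hL]
  mem_model e he θ t _ := by
    intro hκ
    obtain ⟨h1, h2⟩ := h e he t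
    have hs : (radiusOfVolume κ (w₀ + e * φ t) * cos θ) ^ 2
        + (radiusOfVolume κ (w₀ + e * φ t) * sin θ) ^ 2
        = radiusOfVolume κ (w₀ + e * φ t) ^ 2 := by
      linear_combination radiusOfVolume κ (w₀ + e * φ t) ^ 2 * sin_sq_add_cos_sq θ
    simp only [revolutionVariation, cylinderParam, Matrix.cons_val]
    rw [hs, radiusOfVolume_sq h1 h2, div_pow, Real.sq_sqrt (neg_pos.2 hκ).le,
      div_lt_div_iff₀ h2 (neg_pos.2 hκ)]
    -- The two sides differ by the constant `8`.
    nlinarith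
  immersion e he θ t _ := by
    obtain ⟨h1, h2⟩ := h e he t
    have hR := radiusOfVolume_pos h1 h2
    have hw : HasDerivAt (fun y => w₀ + e * φ y) (e * deriv φ t) t :=
      (((hφ.differentiable (by simp)) t).hasDerivAt.const_mul e).const_add w₀
    have hRt := (hasDerivAt_radiusOfVolume h1 h2).comp t hw
    have hd1 : deriv (fun x => revolutionVariation κ w₀ φ e x t) θ = _ :=
      (hasDerivAt_cylinderParam_angle _ θ t).deriv
    have hd2 : deriv (fun y => revolutionVariation κ w₀ φ e θ y) t = _ :=
      (hasDerivAt_cylinderParam_height hRt θ).deriv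
    rw [hd1, hd2, LinearIndependent.pair_iff]
    intro a b hab
    have hb : b = 0 := by simpa using congrFun hab 2
    subst hb
    have ha0 : a * (radiusOfVolume κ (w₀ + e * φ t) * sin θ) = 0 := by
      simpa using congrFun hab 0
    have ha1 : a * (radiusOfVolume κ (w₀ + e * φ t) * cos θ) = 0 := by
      simpa using congrFun hab 1
    have h3 : a * radiusOfVolume κ (w₀ + e * φ t) = 0 := by
      linear_combination sin θ * ha0 + cos θ * ha1
        - a * radiusOfVolume κ (w₀ + e * φ t) * sin_sq_add_cos_sq θ
    exact ⟨(mul_eq_zero.1 h3).resolve_right hR.ne', rfl⟩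

theorem hasDerivAt_radiusOfVolume_time {e t : ℝ}
    (h : 0 < w₀ + e * φ t ∧ 0 < 2 - κ * (w₀ + e * φ t)) :
    HasDerivAt (fun b => radiusOfVolume κ (w₀ + b * φ t))
      (4 / ((2 - κ * (w₀ + e * φ t)) ^ 2 * radiusOfVolume κ (w₀ + e * φ t)) * φ t) e := by
  have hw : HasDerivAt (fun b => w₀ + b * φ t) (φ t) e := by
    simpa using ((hasDerivAt_id e).mul_const (φ t)).const_add w₀
  exact HasDerivAt.comp (h₂ := radiusOfVolume κ) e (hasDerivAt_radiusOfVolume h.1 h.2) hw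

/-- The form `y dx - x dy` vanishes on radial vectors, so the variation field is horizontal and
radial, hence orthogonal to the circles and to the vertical direction. -/
theorem isNormalVariation_revolutionVariation {τ L : ℝ} (h : 0 < w₀ ∧ 0 < 2 - κ * w₀) :
    IsNormalVariation κ τ L (revolutionVariation κ w₀ φ) := by
  intro θ t _
  have hd0 : deriv (fun e => revolutionVariation κ w₀ φ e θ t) 0 = _ :=
    (hasDerivAt_cylinderParam_radius
      (hasDerivAt_radiusOfVolume_time (φ := φ) (t := t) (by simpa using h)) θ t).deriv
  have hd1 : deriv (fun x => revolutionVariation κ w₀ φ 0 x t) θ = _ :=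
    (hasDerivAt_cylinderParam_angle _ θ t).deriv
  have hd2 : deriv (fun y => revolutionVariation κ w₀ φ 0 θ y) t = ![0 * cos θ, 0 * sin θ, 1] := by
    simp only [revolutionVariation, zero_mul, add_zero]
    simpa using (hasDerivAt_cylinderParam_height (hasDerivAt_const t (radiusOfVolume κ w₀)) θ).deriv
  rw [hd0, hd1, hd2]
  constructor <;>
  · simp only [metric, revolutionVariation, cylinderParam, Matrix.cons_val]
    ring

/-- The Jacobian `σ² R ∂R/∂e` equals `∂w/∂e = φ t`, independently of time and angle. -/
theorem enclosedVolume_revolutionVariation {τ L : ℝ}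
    (h : ∀ e ∈ Ioo (-δ) δ, ∀ t, 0 < w₀ + e * φ t ∧ 0 < 2 - κ * (w₀ + e * φ t))
    (hφ : Differentiable ℝ φ) {e : ℝ} (he : e ∈ Ioo (-δ) δ) :
    enclosedVolume κ τ L (revolutionVariation κ w₀ φ) e
      = e * (2 * π * ∫ t in (0 : ℝ)..L, φ t) := by
  have hδ : 0 < δ := by linarith [he.1, he.2]
  have key : ∀ a ∈ uIcc 0 e, ∀ θ t,
      volumeDensity κ τ (revolutionVariation κ w₀ φ a θ t) *
        Matrix.det (Matrix.of ![deriv (fun b => revolutionVariation κ w₀ φ b θ t) a,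
          deriv (fun x => revolutionVariation κ w₀ φ a x t) θ,
          deriv (fun y => revolutionVariation κ w₀ φ a θ y) t]) = φ t := by
    intro a ha θ t
    -- Since `e` may be negative, intermediate times range over the unordered interval between `0`
    -- and `e`.
    have ha' : a ∈ Ioo (-δ) δ :=
      (ordConnected_Ioo.uIcc_subset (by constructor <;> linarith) he) ha
    have hw := h a ha' t
    obtain ⟨h1, h2⟩ := hw
    have hR := radiusOfVolume_pos h1 h2
    have hwt : HasDerivAt (fun y => w₀ + a * φ y) (a * deriv φ t) t :=
      ((hφ t).hasDerivAt.const_mul a).const_add w₀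
    have hRt := (hasDerivAt_radiusOfVolume h1 h2).comp t hwt
    have hd0 : deriv (fun e => revolutionVariation κ w₀ φ e θ t) a = _ :=
      (hasDerivAt_cylinderParam_radius (hasDerivAt_radiusOfVolume_time ⟨h1, h2⟩) θ t).deriv
    have hd1 : deriv (fun x => revolutionVariation κ w₀ φ a x t) θ = _ :=
      (hasDerivAt_cylinderParam_angle _ θ t).deriv
    have hd2 : deriv (fun y => revolutionVariation κ w₀ φ a θ y) t = _ :=
      (hasDerivAt_cylinderParam_height hRt θ).deriv
    rw [hd0, hd1, hd2, volumeDensity_eq, revolutionVariation, sigma_cylinderParam,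
      conformalFactor_radiusOfVolume h1 h2]
    have hcs := sin_sq_add_cos_sq θ
    generalize radiusOfVolume κ (w₀ + a * φ t) = R at *
    generalize w₀ + a * φ t = w at *
    have hk : ((2 - κ * w) / 2) ^ 2 * (4 / ((2 - κ * w) ^ 2 * R)) * R = 1 := by
      field_simp
      norm_num
    generalize 4 / ((2 - κ * w) ^ 2 * R) = k at *
    simp only [Matrix.det_fin_three, Matrix.of_apply, Matrix.cons_val]
    linear_combination ((2 - κ * w) / 2) ^ 2 * k * R * φ t * hcs + φ t * hk
  have h2 : ∀ a ∈ uIcc 0 e, (∫ θ in (0 : ℝ)..(2 * π), ∫ t in (0 : ℝ)..L,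
      volumeDensity κ τ (revolutionVariation κ w₀ φ a θ t) *
        Matrix.det (Matrix.of ![deriv (fun b => revolutionVariation κ w₀ φ b θ t) a,
          deriv (fun x => revolutionVariation κ w₀ φ a x t) θ,
          deriv (fun y => revolutionVariation κ w₀ φ a θ y) t]))
      = 2 * π * ∫ t in (0 : ℝ)..L, φ t := by
    intro a ha
    simp only [key a ha]
    simp
  rw [enclosedVolume, intervalIntegral.integral_congr h2]
  simp
  ring

/-- Substitute `σ²R² = w(2 - κw)`, `σ⁴R²R'² = w'²` and `R² = 4w/(2 - κw)` in `gram_cylinderParam`.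
-/
theorem area_revolutionVariation {τ L e : ℝ}
    (h : ∀ t, 0 < w₀ + e * φ t ∧ 0 < 2 - κ * (w₀ + e * φ t)) (hφ : Differentiable ℝ φ) :
    area κ τ L (revolutionVariation κ w₀ φ e)
      = ∫ t in (0 : ℝ)..L, 2 * π * √(2 * (w₀ + e * φ t) - κ * (w₀ + e * φ t) ^ 2
          + (1 + 4 * τ ^ 2 * (w₀ + e * φ t) / (2 - κ * (w₀ + e * φ t)))
            * (e * deriv φ t) ^ 2) := by
  have key : ∀ θ t,
      metric κ τ (revolutionVariation κ w₀ φ e θ t)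
          (deriv (fun x => revolutionVariation κ w₀ φ e x t) θ)
          (deriv (fun x => revolutionVariation κ w₀ φ e x t) θ)
        * metric κ τ (revolutionVariation κ w₀ φ e θ t)
          (deriv (fun y => revolutionVariation κ w₀ φ e θ y) t)
          (deriv (fun y => revolutionVariation κ w₀ φ e θ y) t)
        - metric κ τ (revolutionVariation κ w₀ φ e θ t)
          (deriv (fun x => revolutionVariation κ w₀ φ e x t) θ)
          (deriv (fun y => revolutionVariation κ w₀ φ e θ y) t) ^ 2
      = 2 * (w₀ + e * φ t) - κ * (w₀ + e * φ t) ^ 2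
          + (1 + 4 * τ ^ 2 * (w₀ + e * φ t) / (2 - κ * (w₀ + e * φ t)))
            * (e * deriv φ t) ^ 2 := by
    intro θ t
    obtain ⟨h1, h2⟩ := h t
    have hR := radiusOfVolume_pos h1 h2
    have hR2 := radiusOfVolume_sq h1 h2
    have hwt : HasDerivAt (fun y => w₀ + e * φ y) (e * deriv φ t) t :=
      ((hφ t).hasDerivAt.const_mul e).const_add w₀
    have hRt := (hasDerivAt_radiusOfVolume h1 h2).comp t hwt
    have hd1 : deriv (fun x => revolutionVariation κ w₀ φ e x t) θ = _ :=
      (hasDerivAt_cylinderParam_angle _ θ t).deriv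
    have hd2 : deriv (fun y => revolutionVariation κ w₀ φ e θ y) t = _ :=
      (hasDerivAt_cylinderParam_height hRt θ).deriv
    have hg := gram_cylinderParam κ τ (radiusOfVolume κ (w₀ + e * φ t))
      (4 / ((2 - κ * (w₀ + e * φ t)) ^ 2 * radiusOfVolume κ (w₀ + e * φ t)) * (e * deriv φ t)) θ t
    rw [hd1, hd2]
    refine hg.trans ?_
    rw [conformalFactor_radiusOfVolume h1 h2, mul_pow _ (e * deriv φ t), div_pow 4, mul_pow _
      (radiusOfVolume κ (w₀ + e * φ t)), hR2]
    generalize w₀ + e * φ t = w at *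
    field_simp
    ring
  simp only [area, key]
  simp

end RevolutionVariation

/-! ### The second variation of area. -/

section SecondVariation

variable {κ τ w₀ : ℝ}

/-- The square of the area density `E G - F²` of a surface of revolution in terms of the
volume coordinate `w` and its derivative `q` along the axis. -/
def revolutionGram (κ τ w q : ℝ) : ℝ :=
  2 * w - κ * w ^ 2 + (1 + 4 * τ ^ 2 * w / (2 - κ * w)) * q ^ 2

theorem revolutionGram_pos {w : ℝ} (hw : 0 < w) (hκ : 0 < 2 - κ * w) (q : ℝ) :
    0 < revolutionGram κ τ w q := by
  have h1 : 0 < w * (2 - κ * w) := mul_pos hw hκ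
  have h2 : 0 ≤ (1 + 4 * τ ^ 2 * w / (2 - κ * w)) * q ^ 2 := by positivity
  unfold revolutionGram
  linarith

/-- The terms containing `q` are kept as `e * (…)`: at `e = 0` their next derivative is just the
value of the bracket. -/
theorem hasDerivAt_revolutionGram (p q : ℝ) {e : ℝ} (hκ : 0 < 2 - κ * (w₀ + e * p)) :
    HasDerivAt (fun x => revolutionGram κ τ (w₀ + x * p) (x * q))
      ((2 - 2 * κ * (w₀ + e * p)) * p
        + e * (8 * τ ^ 2 / (2 - κ * (w₀ + e * p)) ^ 2 * p * q ^ 2 * e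
          + 2 * (1 + 4 * τ ^ 2 * (w₀ + e * p) / (2 - κ * (w₀ + e * p))) * q ^ 2)) e := by
  have hw : HasDerivAt (fun x => w₀ + x * p) p e := by
    simpa using ((hasDerivAt_id e).mul_const p).const_add w₀
  have hq : HasDerivAt (fun x => x * q) q e := by
    simpa using (hasDerivAt_id e).mul_const q
  have hT := ((hw.const_mul (4 * τ ^ 2)).div ((hw.const_mul κ).const_sub 2) hκ.ne').const_add 1
  refine ((((hw.const_mul 2).sub ((hw.pow 2).const_mul κ)).add (hT.mul (hq.pow 2)))).congr_deriv ?_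
  simp only [Pi.div_apply, Pi.pow_apply]
  push_cast
  field_simp
  ring

/-- With `a² = w₀(2 - κw₀)`, the `p²` terms are `-κ/a - (1 - κw₀)²/a³`. They combine into `-1/a³`
because `κa² + (1 - κw₀)² = 1`. -/
theorem deriv_deriv_sqrt_revolutionGram (p q : ℝ) (hw : 0 < w₀) (hκ : 0 < 2 - κ * w₀) :
    deriv (fun y => deriv (fun x => √(revolutionGram κ τ (w₀ + x * p) (x * q))) y) 0
      = ((1 + 4 * τ ^ 2 * w₀ / (2 - κ * w₀)) * q ^ 2 - p ^ 2 / (w₀ * (2 - κ * w₀)))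
        / √(w₀ * (2 - κ * w₀)) := by
  have hev : ∀ᶠ e in nhds (0 : ℝ), 0 < w₀ + e * p ∧ 0 < 2 - κ * (w₀ + e * p) := by
    refine (ContinuousAt.eventually_lt (by fun_prop) (by fun_prop) ?_).and
      (ContinuousAt.eventually_lt (by fun_prop) (by fun_prop) ?_) <;>
      simpa only [zero_mul, add_zero]
  have hd : (fun y => deriv (fun x => √(revolutionGram κ τ (w₀ + x * p) (x * q))) y)
      =ᶠ[nhds 0] fun e => ((2 - 2 * κ * (w₀ + e * p)) * p
        + e * (8 * τ ^ 2 / (2 - κ * (w₀ + e * p)) ^ 2 * p * q ^ 2 * e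
          + 2 * (1 + 4 * τ ^ 2 * (w₀ + e * p) / (2 - κ * (w₀ + e * p))) * q ^ 2))
        / (2 * √(revolutionGram κ τ (w₀ + e * p) (e * q))) := by
    filter_upwards [hev] with e he
    exact ((hasDerivAt_revolutionGram p q he.2).sqrt
      (revolutionGram_pos he.1 he.2 _).ne').deriv
  rw [hd.deriv_eq]
  have hG : DifferentiableAt ℝ (fun e : ℝ => 8 * τ ^ 2 / (2 - κ * (w₀ + e * p)) ^ 2 * p * q ^ 2 * e
      + 2 * (1 + 4 * τ ^ 2 * (w₀ + e * p) / (2 - κ * (w₀ + e * p))) * q ^ 2) 0 := by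
    have h1 : (2 - κ * (w₀ + (0 : ℝ) * p)) ≠ 0 := by simpa using hκ.ne'
    have h2 : (2 - κ * (w₀ + (0 : ℝ) * p)) ^ 2 ≠ 0 := pow_ne_zero 2 h1
    fun_prop (disch := assumption)
  have hlin : HasDerivAt (fun x => (2 - 2 * κ * (w₀ + x * p)) * p) (-(2 * κ * p) * p) 0 := by
    have : HasDerivAt (fun x => w₀ + x * p) p 0 := by
      simpa using ((hasDerivAt_id (0 : ℝ)).mul_const p).const_add w₀
    exact ((this.const_mul (2 * κ)).const_sub 2).mul_const p
  -- Only differentiability of the bracket matters; its derivative is multiplied by `e = 0`.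
  have hnum := hlin.add ((hasDerivAt_id (0 : ℝ)).mul hG.hasDerivAt)
  have h0 : 0 < revolutionGram κ τ (w₀ + 0 * p) (0 * q) :=
    revolutionGram_pos (by simpa) (by simpa only [zero_mul, add_zero]) _
  have hsqrt := (hasDerivAt_revolutionGram (κ := κ) (τ := τ) (w₀ := w₀) p q (e := 0)
    (by simpa only [zero_mul, add_zero])).sqrt h0.ne'
  have hquot := hnum.div (hsqrt.const_mul 2) (mul_pos two_pos (Real.sqrt_pos.2 h0)).ne'
  refine hquot.deriv.trans ?_
  have hgram : revolutionGram κ τ w₀ 0 = w₀ * (2 - κ * w₀) := by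
    unfold revolutionGram
    ring
  have ha : 0 < w₀ * (2 - κ * w₀) := mul_pos hw hκ
  have hs := Real.sq_sqrt ha.le
  have hs0 := Real.sqrt_pos.2 ha
  simp only [Pi.add_apply, Pi.mul_apply, id, zero_mul, add_zero, mul_zero, hgram, one_mul, zero_add]
  rw [← hs]
  rw [Real.sqrt_sq hs0.le]
  generalize 1 + 4 * τ ^ 2 * w₀ / (2 - κ * w₀) = T
  generalize √(w₀ * (2 - κ * w₀)) = a at *
  field_simp
  linear_combination (-κ * p ^ 2) * hs

theorem contDiffOn_sqrt_revolutionGram {δ : ℝ} {φ : ℝ → ℝ} (hφ : ContDiff ℝ ∞ φ)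
    (h : ∀ e ∈ Ioo (-δ) δ, ∀ t, 0 < w₀ + e * φ t ∧ 0 < 2 - κ * (w₀ + e * φ t)) :
    ContDiffOn ℝ ∞ (fun q : ℝ × ℝ => 2 * π *
      √(revolutionGram κ τ (w₀ + q.1 * φ q.2) (q.1 * deriv φ q.2))) (Ioo (-δ) δ ×ˢ univ) := by
  have hφ' : ContDiff ℝ ∞ (deriv φ) := (contDiff_infty_iff_deriv.1 hφ).2
  refine contDiffOn_const.mul (ContDiffOn.sqrt ?_ fun q hq =>
    (revolutionGram_pos (h q.1 hq.1 q.2).1 (h q.1 hq.1 q.2).2 _).ne')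
  unfold revolutionGram
  refine ContDiffOn.add (by fun_prop) (ContDiffOn.mul (contDiffOn_const.add ?_) (by fun_prop))
  exact ContDiffOn.div (by fun_prop) (by fun_prop) fun q hq => (h q.1 hq.1 q.2).2.ne'

theorem iteratedDeriv_two_area_revolutionVariation {δ L : ℝ} {φ : ℝ → ℝ} (hδ : 0 < δ)
    (hφ : ContDiff ℝ ∞ φ)
    (h : ∀ e ∈ Ioo (-δ) δ, ∀ t, 0 < w₀ + e * φ t ∧ 0 < 2 - κ * (w₀ + e * φ t)) :
    iteratedDeriv 2 (fun e => area κ τ L (revolutionVariation κ w₀ φ e)) 0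
      = ∫ t in (0 : ℝ)..L, 2 * π *
        (((1 + 4 * τ ^ 2 * w₀ / (2 - κ * w₀)) * deriv φ t ^ 2 - φ t ^ 2 / (w₀ * (2 - κ * w₀)))
          / √(w₀ * (2 - κ * w₀))) := by
  have h0 : (0 : ℝ) ∈ Ioo (-δ) δ := ⟨by linarith, hδ⟩
  have hev : (fun e => area κ τ L (revolutionVariation κ w₀ φ e)) =ᶠ[nhds 0]
      fun e => ∫ t in (0 : ℝ)..L, 2 * π *
        √(revolutionGram κ τ (w₀ + e * φ t) (e * deriv φ t)) := by
    filter_upwards [isOpen_Ioo.mem_nhds h0] with e he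
    exact area_revolutionVariation (h e he) (hφ.differentiable (by simp))
  rw [hev.iteratedDeriv_eq 2]
  refine (iteratedDeriv_two_integral isOpen_Ioo (contDiffOn_sqrt_revolutionGram hφ h)
    0 L h0).trans ?_
  obtain ⟨hw, hκ⟩ : 0 < w₀ ∧ 0 < 2 - κ * w₀ := by simpa using h 0 h0 0
  simp only [deriv_const_mul_field, deriv_deriv_sqrt_revolutionGram _ _ hw hκ]

end SecondVariation

/-! ### Integrals of the test function over one period. -/

section Sine

theorem integral_sin_sq_period {L : ℝ} (hL : L ≠ 0) :
    ∫ t in (0 : ℝ)..L, sin (2 * π / L * t) ^ 2 = L / 2 := by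
  have hc : 2 * π / L ≠ 0 := by positivity
  rw [intervalIntegral.integral_comp_mul_left (fun x => sin x ^ 2) hc, integral_sin_sq,
    div_mul_cancel₀ _ hL]
  simp
  field_simp

theorem integral_cos_sq_period {L : ℝ} (hL : L ≠ 0) :
    ∫ t in (0 : ℝ)..L, cos (2 * π / L * t) ^ 2 = L / 2 := by
  have hc : 2 * π / L ≠ 0 := by positivity
  rw [intervalIntegral.integral_comp_mul_left (fun x => cos x ^ 2) hc, integral_cos_sq,
    div_mul_cancel₀ _ hL]
  simp
  field_simp

theorem integral_sin_period {L : ℝ} (hL : L ≠ 0) :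
    ∫ t in (0 : ℝ)..L, sin (2 * π / L * t) = 0 := by
  have hc : 2 * π / L ≠ 0 := by positivity
  rw [intervalIntegral.integral_comp_mul_left sin hc, integral_sin, div_mul_cancel₀ _ hL]
  simp

end Sine

theorem exists_time_bound {κ w₀ : ℝ} (hw : 0 < w₀) (hκ : 0 < 2 - κ * w₀) {φ : ℝ → ℝ}
    (hφ : ∀ t, |φ t| ≤ 1) :
    ∃ δ > 0, ∀ e ∈ Ioo (-δ) δ, ∀ t, 0 < w₀ + e * φ t ∧ 0 < 2 - κ * (w₀ + e * φ t) := by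
  -- The two entries keep `w` positive and `2 - κw` positive; the `+ 1` keeps the denominator
  -- positive when `κ = 0`.
  refine ⟨min w₀ ((2 - κ * w₀) / (|κ| + 1)), by positivity, fun e he t => ?_⟩
  have he' := abs_lt.2 he
  have h1 := he'.trans_le (min_le_left _ _)
  have h2 := (lt_div_iff₀ (by positivity)).1 (he'.trans_le (min_le_right _ _))
  have h3 : |e * φ t| ≤ |e| := by
    rw [abs_mul]
    exact mul_le_of_le_one_right (abs_nonneg e) (hφ t)
  have h4 : κ * (e * φ t) ≤ |κ| * |e| :=
    (le_abs_self _).trans ((abs_mul _ _).le.trans (by gcongr))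
  constructor
  · linarith [neg_abs_le (e * φ t)]
  · linarith [abs_nonneg e]

end EKT

end

/-! ### Instability beyond the critical length. -/

theorem theorem1p2 (κ τ r ρ L : ℝ) (hr : 0 < r) (hrκ : κ < 0 → r < 2 / √(-κ))
    (hρ : ρ = EKT.circleRadius κ r)
    (hL : EKT.criticalLength κ τ ρ < L)
    (hBerger : 0 < κ → τ ≠ 0 → L < 8 * |τ| * π / κ) :
    ¬ EKT.IsStable κ τ r L := by
  intro hstable
  have hD := EKT.four_add_mul_sq_pos hr.le hrκ
  rw [hρ, EKT.criticalLength_circleRadius κ τ r hr hrκ] at hL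
  have hL0 : 0 < L := lt_of_le_of_lt (by positivity) hL
  -- The value of `∫₀ʳ σ² s ds`, so the variation starts at the given cylinder.
  set w₀ := 2 * r ^ 2 / (4 + κ * r ^ 2) with hw₀
  have hw : 0 < w₀ := by positivity
  have h8 : 2 - κ * w₀ = 8 / (4 + κ * r ^ 2) := by
    rw [hw₀]
    field_simp
    ring
  have hκ : 0 < 2 - κ * w₀ := by
    rw [h8]
    positivity
  have ha : w₀ * (2 - κ * w₀) = (4 * r / (4 + κ * r ^ 2)) ^ 2 := by
    rw [h8, hw₀]
    field_simp
    norm_num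
  have hT : 1 + 4 * τ ^ 2 * w₀ / (2 - κ * w₀) = 1 + τ ^ 2 * r ^ 2 := by
    rw [h8, hw₀]
    generalize 4 + κ * r ^ 2 = D at *
    field_simp
    ring
  have ha0 : 0 < 4 * r / (4 + κ * r ^ 2) := by positivity
  set a := 4 * r / (4 + κ * r ^ 2)
  -- A full period is needed: half a period also vanishes at both ends, but its mean is not zero.
  let φ : ℝ → ℝ := fun t => sin (2 * π / L * t)
  have hφ : ContDiff ℝ ∞ φ := by fun_prop
  have hφ' : ∀ t, deriv φ t = 2 * π / L * cos (2 * π / L * t) := by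
    intro t
    have := ((hasDerivAt_id t).const_mul (2 * π / L)).sin
    refine this.deriv.trans ?_
    simp only [id]
    ring
  have hφ0 : φ 0 = 0 := by simp [φ]
  have hφL : φ L = 0 := by simp [φ, div_mul_cancel₀ _ hL0.ne']
  obtain ⟨δ, hδ, h⟩ := EKT.exists_time_bound (φ := φ) hw hκ fun t => abs_sin_le_one _
  have hA := hstable δ (EKT.revolutionVariation κ w₀ φ) hδ
    (EKT.isVariation_revolutionVariation h hφ hφ0 hφL (EKT.radiusOfVolume_of_circle hr hD))
    (EKT.isNormalVariation_revolutionVariation ⟨hw, hκ⟩) fun e he => by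
      rw [EKT.enclosedVolume_revolutionVariation h (hφ.differentiable (by simp)) he,
        EKT.integral_sin_period hL0.ne']
      simp
  rw [EKT.iteratedDeriv_two_area_revolutionVariation hδ hφ h, hT, ha, Real.sqrt_sq ha0.le] at hA
  -- Over a full period `sin²` and `cos²` both integrate to `L/2`, so the sign depends only on
  -- `T(2π/L)² - 1/a²`.
  have hval : ∫ t in (0 : ℝ)..L, 2 * π *
      (((1 + τ ^ 2 * r ^ 2) * deriv φ t ^ 2 - φ t ^ 2 / a ^ 2) / a)
      = π * L / a * ((1 + τ ^ 2 * r ^ 2) * (2 * π / L) ^ 2 - 1 / a ^ 2) := by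
    have hsplit : ∀ t, 2 * π * (((1 + τ ^ 2 * r ^ 2) * deriv φ t ^ 2 - φ t ^ 2 / a ^ 2) / a)
        = 2 * π / a * (1 + τ ^ 2 * r ^ 2) * (2 * π / L) ^ 2 * cos (2 * π / L * t) ^ 2
          - 2 * π / a ^ 3 * sin (2 * π / L * t) ^ 2 := by
      intro t
      rw [hφ']
      simp only [φ]
      field_simp
    simp only [hsplit]
    rw [intervalIntegral.integral_sub (Continuous.intervalIntegrable (by fun_prop) _ _)
      (Continuous.intervalIntegrable (by fun_prop) _ _), intervalIntegral.integral_const_mul,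
      intervalIntegral.integral_const_mul, EKT.integral_sin_sq_period hL0.ne',
      EKT.integral_cos_sq_period hL0.ne']
    field_simp
  rw [hval] at hA
  have hTs := Real.sq_sqrt (show 0 ≤ 1 + τ ^ 2 * r ^ 2 by positivity)
  have hlt : (2 * π * a * √(1 + τ ^ 2 * r ^ 2)) ^ 2 < L ^ 2 :=
    pow_lt_pow_left₀ hL (by positivity) two_ne_zero
  have hneg : (1 + τ ^ 2 * r ^ 2) * (2 * π / L) ^ 2 - 1 / a ^ 2 < 0 := by
    rw [div_pow, ← mul_div_assoc, sub_neg, div_lt_div_iff₀ (by positivity) (by positivity)]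
    rw [mul_pow, hTs] at hlt
    linarith
  exact absurd hA (not_le.2 (mul_neg_of_pos_of_neg (by positivity) hneg))
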